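/- For real $\alpha$ and $n\ge 0$ let $L^{\alpha}_n(z)=\sum_{k=0}^n \frac{(-1)^k}{k!}\binom{n+\alpha}{n-k}z^k$ be the classical Laguerre polynomial, put $\xi_{\alpha,m}(z)=L^{\alpha}_m(-z)$, and for $m,j\ge 0$ let $$L^{\mathrm I}_{\alpha,m,m+j}=\xi_{\alpha,m}\,L^{\alpha-1}_j-\xi_{\alpha-1,m}\,\bigl(L^{\alpha-1}_j\bigr)'$$ be the type I exceptional $X_m$-Laguerre polynomial of degree $m+j$. Let $\alpha>0$ and let $m\ge 0$ be an integer. For every $j\ge 0$ the polynomial $L^{\mathrm I}_{\alpha,m,m+j}$ has exactly $m$ zeros $x_{j,1}<\dots<x_{j,m}$ in $(-\infty,0)$, all simple; the complex zeros of $z\mapsto L^{\alpha-1}_m(-z)$ are exactly $m$ simple negative real numbers $\zeta_1<\dots<\zeta_m$; and $$\lim_{j\to\infty}x_{j,i}=\zeta_i\qquad(i=1,\dots,m).$$ -/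

import Mathlib

open Polynomial Filter Topology

noncomputable section

/-- The classical (associated) Laguerre polynomial
`L^α_n(z) = ∑_{k=0}^n (-1)^k / k! * binom(n+α, n-k) * z^k`, for an arbitrary real parameter `α`,
where `binom(n+α, n-k) = (α+k+1)(α+k+2)⋯(α+n) / (n-k)!`. -/
def laguerre (α : ℝ) (n : ℕ) : ℝ[X] :=
  ∑ k ∈ Finset.range (n + 1),
    C ((-1) ^ k / (k.factorial : ℝ) *
      ((ascPochhammer ℝ (n - k)).eval (α + k + 1) / ((n - k).factorial : ℝ))) * X ^ k

/-- `ξ_{α,m}(z) = L^α_m(-z)`. -/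
def laguerreXi (α : ℝ) (m : ℕ) : ℝ[X] := (laguerre α m).comp (-X)

/-- The first order operator `A^I_{α,m}[y] = ξ_{α,m} y' - ξ_{α+1,m} y`. -/
def opAI (α : ℝ) (m : ℕ) (y : ℝ[X]) : ℝ[X] :=
  laguerreXi α m * derivative y - laguerreXi (α + 1) m * y

/-- The type I exceptional `X_m`-Laguerre polynomial
`L^I_{α,m,m+j} = -A^I_{α-1,m}[L^{α-1}_j]`, of degree `m + j`. -/
def excLaguerreI (α : ℝ) (m j : ℕ) : ℝ[X] := -opAI (α - 1) m (laguerre (α - 1) j)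

theorem laguerre_coeff (α : ℝ) (n k : ℕ) :
    (laguerre α n).coeff k = if k ≤ n then (-1) ^ k / (k.factorial : ℝ) *
      ((ascPochhammer ℝ (n - k)).eval (α + k + 1) / ((n - k).factorial : ℝ)) else 0 := by
  simp only [laguerre, finsetSum_coeff, coeff_C_mul, coeff_X_pow, mul_ite, mul_one, mul_zero,
    Finset.sum_ite_eq, Finset.mem_range, Nat.lt_succ_iff]

/-- `L^α_n` solves the Laguerre equation `z y'' + (α + 1 - z) y' = - n y`. -/
theorem laguerre_ode (α : ℝ) (n : ℕ) :
    X * derivative (derivative (laguerre α n))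
      + (C (α + 1) - X) * derivative (laguerre α n) = -(C (n : ℝ) * laguerre α n) := by
  have key : ∀ k : ℕ, ((k : ℝ) + 1) * (k + α + 1) * (laguerre α n).coeff (k + 1)
      = (k - n) * (laguerre α n).coeff k := by
    intro k
    rw [laguerre_coeff, laguerre_coeff]
    rcases lt_trichotomy k n with h | h | h
    · obtain ⟨d, rfl⟩ := Nat.exists_eq_add_of_lt h
      have e1 : k + d + 1 - (k + 1) = d := by omega
      have e2 : k + d + 1 - k = d + 1 := by omega
      rw [if_pos (by omega), if_pos (by omega), e1, e2, ascPochhammer_succ_left]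
      simp only [eval_mul, eval_X, eval_comp, eval_add, eval_one, Nat.factorial_succ]
      have h1 : (k.factorial : ℝ) ≠ 0 := by positivity
      have h2 : (d.factorial : ℝ) ≠ 0 := by positivity
      have h3 : ((k : ℝ) + 1) ≠ 0 := by positivity
      have h4 : ((d : ℝ) + 1) ≠ 0 := by positivity
      push_cast
      rw [show α + ((k : ℝ) + 1) + 1 = α + k + 1 + 1 by ring]
      field_simp
      ring
    · subst h; simp
    · rw [if_neg (by omega), if_neg (by omega)]; simp
  ext k
  rw [sub_mul]
  rcases k with _ | k
  · have := key 0
    simp [coeff_derivative, mul_coeff_zero] at this ⊢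
    linarith
  · have := key (k + 1)
    simp only [coeff_add, coeff_sub, coeff_X_mul, coeff_C_mul, coeff_neg, coeff_derivative]
    push_cast at this ⊢
    linarith

/-- The normalization `y^{(n)}(0) = (-1)^n`. -/
theorem laguerre_normalization (α : ℝ) (n : ℕ) :
    (derivative^[n] (laguerre α n)).eval 0 = (-1) ^ n := by
  rw [← coeff_zero_eq_eval_zero, coeff_iterate_derivative, laguerre_coeff]
  have h1 : (n.factorial : ℝ) ≠ 0 := by positivity
  simp [Nat.descFactorial_self]
  field_simp

end

/-!
Write `a = α - 1 > -1`, `M = L^a_m`, `y = L^a_j` and `P = L^I_{α,m,m+j}`. Since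
`L^{a+1}_m = M - M'` (`laguerre_add_one`),
`P(z) = (M(-z) - M'(-z)) y(z) - M(-z) y'(z)`.

Every zero count comes from one principle, `exists_interlacing_roots`: a polynomial whose signs at
the nodes of a real-rooted `Q` are opposite to those of `Q'`, and which agrees in sign with `Q` at
`+∞`, has a zero to the right of each node and before the next. By induction on the degree it shows
that Laguerre polynomials with parameter `> -1` have only simple positive zeros
(`exists_laguerre_eq_nodal`); hence `y > 0` on the negative axis and `M(-z) > 0` on the positive
one. At a zero `r` of `y`, `P(r) = -M(-r) y'(r)`; at a zero `w` of `M`, `P(-w) = -M'(w) y(-w)`.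
So the principle applies to `P(z)` with `Q = y`, giving `j` positive zeros, and to `P(-z)` with
`Q = M`, giving `m` negative ones. Together they exhaust the degree `m + j`, so all are simple and
no others exist; moreover, for each zero `w` of `M` there is exactly one zero of `P(-z)` between `w`
and the next zero of `M` (`neg_zeros_excLaguerreI`).

For the limit, put `S = -y'(-x) / y(-x)` with `x > 0`. Laguerre's inequality `y y'' ≤ y'^2` turns
the differential equation into `j ≤ x S² + (a + 1 + x) S`, so `S → ∞` as `j → ∞`
(`eventually_mul_eval_lt_neg_eval_derivative`). Dividing by `M(x) y(-x)`,
`P(-x) / (M(x) y(-x)) = 1 - M'(x) / M(x) + S`, so `P(-x)` eventually has the sign of `M(x)`. For `x`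
slightly larger than a zero `w` of `M` this is the sign of `M'(w)`, opposite to that of `P(-w)`;
the zero of `P(-z)` belonging to `w` is therefore eventually in `(w, x)`.
-/

/-! ### Real-rooted polynomials and interlacing -/

/-- If `x` lies on the same side as the node `r i` of every other node, then `Q x` has the sign
of `Q' (r i) * (x - r i)`. -/
theorem eval_derivative_mul_eval_pos {ι : Type*} [Fintype ι] [DecidableEq ι] {c : ℝ}
    (hc : c ≠ 0) (r : ι → ℝ) (i : ι) (x : ℝ) (h : ∀ k ≠ i, 0 < (r i - r k) * (x - r k))
    (hx : x ≠ r i) :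
    0 < (derivative (C c * Lagrange.nodal Finset.univ r)).eval (r i) *
      (C c * Lagrange.nodal Finset.univ r).eval x * (x - r i) := by
  have h1 : (derivative (C c * Lagrange.nodal Finset.univ r)).eval (r i)
      = c * ∏ k ∈ Finset.univ.erase i, (r i - r k) := by
    rw [derivative_C_mul, eval_C_mul,
      Lagrange.eval_nodal_derivative_eval_node_eq (Finset.mem_univ i), Lagrange.eval_nodal]
  have h2 : (C c * Lagrange.nodal Finset.univ r).eval x
      = c * ((x - r i) * ∏ k ∈ Finset.univ.erase i, (x - r k)) := by
    rw [eval_C_mul, Lagrange.eval_nodal,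
      Finset.mul_prod_erase _ (fun k => x - r k) (Finset.mem_univ i)]
  have h3 : 0 < (∏ k ∈ Finset.univ.erase i, (r i - r k)) *
      ∏ k ∈ Finset.univ.erase i, (x - r k) := by
    rw [← Finset.prod_mul_distrib]
    exact Finset.prod_pos fun k hk => h k (Finset.ne_of_mem_erase hk)
  have h4 : 0 < c ^ 2 * (x - r i) ^ 2 := by
    have := sub_ne_zero.2 hx
    positivity
  rw [h1, h2]
  nlinarith [mul_pos h4 h3]

theorem eval_derivative_mul_eval_pos_of_gt {n : ℕ} {c : ℝ} (hc : c ≠ 0) {r : Fin n → ℝ}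
    (hr : StrictMono r) {i : Fin n} {x : ℝ} (hx : r i < x) (h : ∀ k, i < k → x < r k) :
    0 < (derivative (C c * Lagrange.nodal Finset.univ r)).eval (r i) *
      (C c * Lagrange.nodal Finset.univ r).eval x := by
  refine pos_of_mul_pos_left
    (eval_derivative_mul_eval_pos hc r i x (fun k hk => ?_) hx.ne') (sub_pos.2 hx).le
  rcases lt_or_gt_of_ne hk with hk | hk
  · have := hr hk
    exact mul_pos (by linarith) (by linarith)
  · have := h k hk
    exact mul_pos_of_neg_of_neg (by linarith [hr hk]) (by linarith)

theorem eval_derivative_mul_eval_neg_of_lt {n : ℕ} {c : ℝ} (hc : c ≠ 0) {r : Fin n → ℝ}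
    (hr : StrictMono r) {i : Fin n} {x : ℝ} (hx : x < r i) (h : ∀ k, k < i → r k < x) :
    (derivative (C c * Lagrange.nodal Finset.univ r)).eval (r i) *
      (C c * Lagrange.nodal Finset.univ r).eval x < 0 := by
  refine neg_of_mul_pos_left
    (eval_derivative_mul_eval_pos hc r i x (fun k hk => ?_) hx.ne) (sub_neg.2 hx).le
  rcases lt_or_gt_of_ne hk with hk | hk
  · have := h k hk
    exact mul_pos (by linarith [hr hk]) (by linarith)
  · have := hr hk
    exact mul_pos_of_neg_of_neg (by linarith) (by linarith)

theorem eval_derivative_node_ne_zero {n : ℕ} {c : ℝ} (hc : c ≠ 0) {r : Fin n → ℝ}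
    (hr : StrictMono r) (i : Fin n) :
    (derivative (C c * Lagrange.nodal Finset.univ r)).eval (r i) ≠ 0 := by
  rw [derivative_C_mul, eval_C_mul,
    Lagrange.eval_nodal_derivative_eval_node_eq (Finset.mem_univ i), Lagrange.eval_nodal]
  exact mul_ne_zero hc (Finset.prod_ne_zero_iff.2 fun k hk =>
    sub_ne_zero.2 (hr.injective.ne (Finset.ne_of_mem_erase hk).symm))

theorem exists_eval_eq_zero_of_mul_neg (F : ℝ[X]) {a b : ℝ} (hab : a < b)
    (h : F.eval a * F.eval b < 0) : ∃ v, a < v ∧ v < b ∧ F.eval v = 0 := by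
  have hcont : ContinuousOn (fun x => F.eval x) (Set.Icc a b) := F.continuous.continuousOn
  rcases mul_neg_iff.1 h with ⟨ha, hb⟩ | ⟨ha, hb⟩
  · obtain ⟨v, hv, hv0⟩ := intermediate_value_Ioo' hab.le hcont ⟨hb, ha⟩
    exact ⟨v, hv.1, hv.2, hv0⟩
  · obtain ⟨v, hv, hv0⟩ := intermediate_value_Ioo hab.le hcont ⟨ha, hb⟩
    exact ⟨v, hv.1, hv.2, hv0⟩

theorem eventually_eval_pos_of_leadingCoeff_pos (F : ℝ[X]) (h : 0 < F.leadingCoeff) :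
    ∀ᶠ x in atTop, 0 < F.eval x := by
  by_cases hd : 0 < F.degree
  · exact (F.tendsto_atTop_of_leadingCoeff_nonneg hd h.le).eventually_gt_atTop 0
  · obtain ⟨c, rfl⟩ : ∃ c, F = C c := ⟨_, eq_C_of_degree_le_zero (not_lt.1 hd)⟩
    exact Eventually.of_forall fun x => by simpa using h

/-- If `F` is opposite in sign to `Q'` at every node of `Q`, and of the sign of `Q` at `+∞`, then
`F` has a zero in each interval between consecutive nodes and one to the right of the last node. -/
theorem exists_interlacing_roots {n : ℕ} {c : ℝ} (hc : c ≠ 0) {r : Fin n → ℝ}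
    (hr : StrictMono r) (F : ℝ[X])
    (hF : ∀ i, F.eval (r i) *
      (derivative (C c * Lagrange.nodal Finset.univ r)).eval (r i) < 0)
    (hlc : 0 < F.leadingCoeff * c) :
    ∃ v : Fin n → ℝ, StrictMono v ∧ (∀ i, r i < v i) ∧ (∀ i k, i < k → v i < r k) ∧
      ∀ i, F.eval (v i) = 0 := by
  set Q := C c * Lagrange.nodal Finset.univ r with hQ
  have key : ∀ i, ∃ v, r i < v ∧ (∀ k, i < k → v < r k) ∧ F.eval v = 0 := by
    intro i
    by_cases hi : i.val + 1 < n
    · set i' : Fin n := ⟨i.val + 1, hi⟩ with hi'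
      have hlt : r i < r i' := hr (Fin.lt_def.2 (by simp [hi']))
      have hle : ∀ k, i < k → r i' ≤ r k := fun k hk =>
        hr.monotone (Fin.le_def.2 (by simpa [hi'] using hk))
      have hle' : ∀ k, k < i' → r k ≤ r i := fun k hk =>
        hr.monotone (Fin.le_def.2 (by have := Fin.lt_def.1 hk; simp [hi'] at this; omega))
      -- comparing both with the sign of `Q` at the midpoint, `Q'` has opposite signs at the nodes
      have h1 := eval_derivative_mul_eval_pos_of_gt hc hr (i := i) (x := (r i + r i') / 2)
        (by linarith) (fun k hk => by linarith [hle k hk])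
      have h2 := eval_derivative_mul_eval_neg_of_lt hc hr (i := i') (x := (r i + r i') / 2)
        (by linarith) (fun k hk => by linarith [hle' k hk])
      rw [← hQ] at h1 h2
      have h3 : F.eval (r i) * F.eval (r i') < 0 := by
        have a1 := hF i
        have a2 := hF i'
        have := mul_neg_of_pos_of_neg (mul_pos_of_neg_of_neg a1 a2) (mul_neg_of_pos_of_neg h1 h2)
        by_contra hcon
        push Not at hcon
        have h5 : 0 ≤ F.eval (r i) * F.eval (r i') * ((derivative Q).eval (r i) *
          (derivative Q).eval (r i') * Q.eval ((r i + r i') / 2)) ^ 2 := by positivity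
        nlinarith
      obtain ⟨v, hv1, hv2, hv0⟩ := exists_eval_eq_zero_of_mul_neg F hlt h3
      exact ⟨v, hv1, fun k hk => hv2.trans_le (hle k hk), hv0⟩
    · have hlast : ∀ k, ¬ i < k := fun k hk => by have := Fin.lt_def.1 hk; omega
      have hlcQ : (F * Q).leadingCoeff = F.leadingCoeff * c := by
        rw [leadingCoeff_mul, hQ, leadingCoeff_mul, leadingCoeff_C,
          Lagrange.nodal_monic.leadingCoeff, mul_one]
      obtain ⟨x, hx0, hx⟩ := ((eventually_eval_pos_of_leadingCoeff_pos (F * Q)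
        (hlcQ ▸ hlc)).and (eventually_gt_atTop (r i))).exists
      have h1 := eval_derivative_mul_eval_pos_of_gt hc hr hx (fun k hk => absurd hk (hlast k))
      rw [← hQ] at h1
      rw [eval_mul] at hx0
      have h3 : F.eval (r i) * F.eval x < 0 := by
        have := mul_neg_of_neg_of_pos (hF i) (mul_pos hx0 h1)
        by_contra hcon
        push Not at hcon
        have h5 : 0 ≤ F.eval (r i) * F.eval x * ((derivative Q).eval (r i) * Q.eval x) ^ 2 := by
          positivity
        nlinarith
      obtain ⟨v, hv1, -, hv0⟩ := exists_eval_eq_zero_of_mul_neg F hx h3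
      exact ⟨v, hv1, fun k hk => absurd hk (hlast k), hv0⟩
  choose v hv1 hv2 hv0 using key
  exact ⟨v, fun i k hik => (hv2 i k hik).trans (hv1 k), hv1, hv2, hv0⟩

theorem eq_C_mul_nodal_of_eval_eq_zero {n : ℕ} {F : ℝ[X]} (hF : F ≠ 0) (hdeg : F.natDegree ≤ n)
    {v : Fin n → ℝ} (hv : Function.Injective v) (h : ∀ i, F.eval (v i) = 0) :
    F = C F.leadingCoeff * Lagrange.nodal Finset.univ v := by
  have hcard : (Finset.univ.map ⟨v, hv⟩).card = n := by simp
  have hroots := roots_eq_of_natDegree_le_card_of_ne_zero (p := F)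
    (S := Finset.univ.map ⟨v, hv⟩) (by simpa using h) (by simpa using hdeg) hF
  have hle := F.card_roots'
  rw [hroots, Finset.card_val, hcard] at hle
  have := C_leadingCoeff_mul_prod_multiset_X_sub_C (p := F)
    (by rw [hroots, Finset.card_val, hcard]; omega)
  rw [hroots] at this
  conv_lhs => rw [← this]
  rw [Lagrange.nodal_eq, Finset.prod_map_val, Finset.prod_map]
  rfl

/-- Laguerre's inequality for a polynomial with only real zeros. -/
theorem eval_mul_eval_derivative_two_le_sq {ι : Type*} (s : Finset ι) (c : ℝ) (r : ι → ℝ) (x : ℝ) :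
    (C c * Lagrange.nodal s r).eval x *
        (derivative (derivative (C c * Lagrange.nodal s r))).eval x
      ≤ (derivative (C c * Lagrange.nodal s r)).eval x ^ 2 := by
  classical
  have key : (Lagrange.nodal s r).eval x * (derivative (derivative (Lagrange.nodal s r))).eval x
      ≤ (derivative (Lagrange.nodal s r)).eval x ^ 2 := by
    induction s using Finset.induction_on with
    | empty => simp
    | insert i s hi ih =>
      rw [Lagrange.nodal_insert_eq_nodal hi]
      simp only [derivative_mul, derivative_add, derivative_sub, derivative_X, derivative_C,
        eval_add, eval_mul, eval_sub, eval_X, eval_C, sub_zero, one_mul]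
      nlinarith [mul_le_mul_of_nonneg_left ih (sq_nonneg (x - r i)),
        sq_nonneg ((Lagrange.nodal s r).eval x)]
  simp only [derivative_C_mul, eval_C_mul]
  nlinarith [mul_le_mul_of_nonneg_left key (sq_nonneg c)]

/-! ### Laguerre polynomials: identities and leading terms -/

theorem derivative_laguerre_succ (α : ℝ) (n : ℕ) :
    derivative (laguerre α (n + 1)) = -laguerre (α + 1) n := by
  ext k
  rw [coeff_derivative, coeff_neg, laguerre_coeff, laguerre_coeff]
  by_cases h : k ≤ n
  · rw [if_pos (by omega), if_pos h, show n + 1 - (k + 1) = n - k by omega, Nat.factorial_succ,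
      show α + ((k + 1 : ℕ) : ℝ) + 1 = α + 1 + k + 1 by push_cast; ring]
    have h1 : (k.factorial : ℝ) ≠ 0 := by positivity
    have h3 : ((k : ℝ) + 1) ≠ 0 := by positivity
    push_cast
    field_simp
    ring
  · rw [if_neg (by omega), if_neg h]; simp

theorem laguerre_add_one (α : ℝ) (n : ℕ) :
    laguerre (α + 1) n = laguerre α n - derivative (laguerre α n) := by
  ext k
  rw [coeff_sub, coeff_derivative, laguerre_coeff, laguerre_coeff, laguerre_coeff]
  rcases lt_trichotomy k n with h | h | h
  · obtain ⟨d, rfl⟩ := Nat.exists_eq_add_of_lt h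
    rw [if_pos (by omega), if_pos (by omega), if_pos (by omega),
      show k + d + 1 - (k + 1) = d by omega, show k + d + 1 - k = d + 1 by omega,
      ascPochhammer_succ_eval, ascPochhammer_succ_left]
    simp only [eval_mul, eval_X, eval_comp, eval_add, eval_one, Nat.factorial_succ]
    have h1 : (k.factorial : ℝ) ≠ 0 := by positivity
    have h2 : (d.factorial : ℝ) ≠ 0 := by positivity
    have h3 : ((k : ℝ) + 1) ≠ 0 := by positivity
    have h4 : ((d : ℝ) + 1) ≠ 0 := by positivity
    push_cast
    rw [show α + ((k : ℝ) + 1) + 1 = α + 1 + k + 1 by ring,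
      show α + (k : ℝ) + 1 + 1 = α + 1 + k + 1 by ring]
    field_simp
    ring
  · subst h; simp
  · rw [if_neg (by omega), if_neg (by omega), if_neg (by omega)]; simp

theorem natDegree_laguerre (α : ℝ) (n : ℕ) : (laguerre α n).natDegree = n := by
  refine natDegree_eq_of_le_of_coeff_ne_zero (natDegree_le_iff_coeff_eq_zero.2 fun k hk => ?_) ?_
  · rw [laguerre_coeff, if_neg (by omega)]
  · rw [laguerre_coeff, if_pos le_rfl]
    simp [Nat.factorial_ne_zero]

theorem leadingCoeff_laguerre (α : ℝ) (n : ℕ) :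
    (laguerre α n).leadingCoeff = (-1) ^ n / (n.factorial : ℝ) := by
  rw [leadingCoeff, natDegree_laguerre, laguerre_coeff, if_pos le_rfl]
  simp

theorem laguerre_ne_zero (α : ℝ) (n : ℕ) : laguerre α n ≠ 0 := by
  rw [← leadingCoeff_ne_zero, leadingCoeff_laguerre]
  simp [Nat.factorial_ne_zero]

/-! ### Zeros and signs of Laguerre polynomials -/

/-- For `α > -1` the zeros of `L^α_n` are real, positive and simple. The recurrence
`(n + 1) L^α_{n+1} = x (L^{α+1}_n)' + (α + 1 - x) L^{α+1}_n`, read at the zeros of `x L^{α+1}_n`,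
makes the zeros of `L^α_{n+1}` interlace these. -/
theorem exists_laguerre_eq_nodal (n : ℕ) : ∀ α : ℝ, -1 < α →
    ∃ r : Fin n → ℝ, StrictMono r ∧ (∀ i, 0 < r i) ∧
      laguerre α n = C ((-1) ^ n / (n.factorial : ℝ)) * Lagrange.nodal Finset.univ r := by
  induction n with
  | zero =>
    intro α _
    exact ⟨Fin.elim0, fun i => i.elim0, fun i => i.elim0, by simp [laguerre]⟩
  | succ n ih =>
    intro α hα
    obtain ⟨s, hs, hs0, hq⟩ := ih (α + 1) (by linarith)
    set c : ℝ := (-1) ^ n / (n.factorial : ℝ) with hc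
    have hc0 : c ≠ 0 := by simp [hc, Nat.factorial_ne_zero]
    set r : Fin (n + 1) → ℝ := Fin.cons 0 s with hr
    have hQ : X * laguerre (α + 1) n = C c * Lagrange.nodal Finset.univ r := by
      rw [hq, Lagrange.nodal_eq, Lagrange.nodal_eq, Fin.prod_univ_succ]
      simp only [hr, Fin.cons_zero, Fin.cons_succ, C_0, sub_zero]
      ring
    have hrm : StrictMono r := by
      rw [Fin.strictMono_iff_lt_succ]
      intro i
      rcases Fin.eq_zero_or_eq_succ i.castSucc with h | ⟨k, h⟩
      · rw [h]; simpa [hr] using hs0 i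
      · rw [h]
        simp only [hr, Fin.cons_succ]
        apply hs
        have := congrArg Fin.val h
        simp at this
        exact Fin.lt_def.2 (by omega)
    have hrec : ∀ x, (n + 1 : ℝ) * (laguerre α (n + 1)).eval x
        = x * (derivative (laguerre (α + 1) n)).eval x
          + (α + 1 - x) * (laguerre (α + 1) n).eval x := by
      intro x
      have := congrArg (eval x) (laguerre_ode α (n + 1))
      rw [derivative_laguerre_succ] at this
      simp at this
      linarith
    have hQ' : ∀ x, (derivative (C c * Lagrange.nodal Finset.univ r)).eval x
        = (laguerre (α + 1) n).eval x + x * (derivative (laguerre (α + 1) n)).eval x := by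
      intro x
      rw [← hQ]
      simp
    -- at a node, `(n + 1) L^α_{n+1}` is a positive multiple `κ` of the derivative of `x L^{α+1}_n`:
    -- `κ = α + 1` at `0` and `κ = 1` at the zeros of `L^{α+1}_n`
    obtain ⟨v, hv, hvr, -, hv0⟩ := exists_interlacing_roots hc0 hrm (-laguerre α (n + 1))
      (fun i => by
        have hne := eval_derivative_node_ne_zero hc0 hrm i
        have h1 := hrec (r i)
        have h2 := hQ' (r i)
        set D := (derivative (C c * Lagrange.nodal Finset.univ r)).eval (r i)
        obtain ⟨κ, hκ, h3⟩ : ∃ κ : ℝ, 0 < κ ∧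
            (n + 1 : ℝ) * (laguerre α (n + 1)).eval (r i) = κ * D := by
          rcases Fin.eq_zero_or_eq_succ i with rfl | ⟨k, rfl⟩
          · refine ⟨α + 1, by linarith, ?_⟩
            rw [h1, h2]
            simp [hr]
          · refine ⟨1, one_pos, ?_⟩
            have : (laguerre (α + 1) n).eval (s k) = 0 := by
              rw [hq, eval_C_mul, Lagrange.eval_nodal_at_node (Finset.mem_univ k), mul_zero]
            rw [h1, h2]
            simp [hr, this]
        have hD : 0 < D ^ 2 := by positivity
        have h4 : (laguerre α (n + 1)).eval (r i) = κ * D / (n + 1) := by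
          field_simp
          linarith
        rw [eval_neg, h4, neg_mul, neg_lt_zero,
          show κ * D / (n + 1) * D = κ * D ^ 2 / (n + 1) by ring]
        positivity)
      (by
        rw [leadingCoeff_neg, leadingCoeff_laguerre, hc,
          show -((-1) ^ (n + 1) / ((n + 1).factorial : ℝ)) * ((-1) ^ n / (n.factorial : ℝ))
            = ((-1) ^ n * (-1) ^ n) / (((n + 1).factorial : ℝ) * n.factorial) by ring,
          ← mul_pow]
        simp
        positivity)
    refine ⟨v, hv, fun i => lt_of_le_of_lt ?_ (hvr i), ?_⟩
    · exact hrm.monotone (Fin.zero_le i)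
    · rw [← leadingCoeff_laguerre α (n + 1)]
      exact eq_C_mul_nodal_of_eval_eq_zero (laguerre_ne_zero _ _) (natDegree_laguerre _ _).le
        hv.injective (by simpa using hv0)

theorem eval_laguerre_neg_pos {α : ℝ} (hα : -1 < α) (n : ℕ) {x : ℝ} (hx : 0 ≤ x) :
    0 < (laguerre α n).eval (-x) := by
  obtain ⟨r, -, hr, h⟩ := exists_laguerre_eq_nodal n α hα
  have : (laguerre α n).eval (-x) = (∏ i, (x + r i)) / (n.factorial : ℝ) := by
    rw [h, eval_C_mul, Lagrange.eval_nodal,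
      Finset.prod_congr rfl (fun i _ => show -x - r i = -1 * (x + r i) by ring),
      Finset.prod_mul_distrib]
    simp only [Finset.prod_const, Finset.card_univ, Fintype.card_fin]
    rw [div_mul_eq_mul_div, ← mul_assoc, ← mul_pow]
    simp
  rw [this]
  have : 0 < ∏ i, (x + r i) := Finset.prod_pos fun i _ => add_pos_of_nonneg_of_pos hx (hr i)
  positivity

theorem eval_derivative_laguerre_neg_nonpos {α : ℝ} (hα : -1 < α) (n : ℕ) {x : ℝ} (hx : 0 ≤ x) :
    (derivative (laguerre α n)).eval (-x) ≤ 0 := by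
  cases n with
  | zero => simp [laguerre]
  | succ n =>
    rw [derivative_laguerre_succ, eval_neg]
    linarith [eval_laguerre_neg_pos (show -1 < α + 1 by linarith) n hx]

/-! ### Growth in the degree -/

/-- Logarithmic derivatives of `L^α_j` at a fixed `-x ≤ 0` tend to `-∞` as `j → ∞`. With
`S = -y'/y` at `-x`, Laguerre's inequality turns the differential equation into
`j ≤ x S² + (α + 1 + x) S`. -/
theorem eventually_mul_eval_lt_neg_eval_derivative {α : ℝ} (hα : -1 < α) {x : ℝ} (hx : 0 ≤ x)
    (K : ℝ) :
    ∀ᶠ j in atTop, K * (laguerre α j).eval (-x) < -(derivative (laguerre α j)).eval (-x) := by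
  filter_upwards [tendsto_natCast_atTop_atTop.eventually_gt_atTop (x * K ^ 2 + (α + 1 + x) * K)]
    with j hj
  by_contra hcon
  push Not at hcon
  have hpos := eval_laguerre_neg_pos hα j hx
  have hT := eval_derivative_laguerre_neg_nonpos hα j hx
  have hode := congrArg (eval (-x)) (laguerre_ode α j)
  have hlag : (laguerre α j).eval (-x) * (derivative (derivative (laguerre α j))).eval (-x)
      ≤ (derivative (laguerre α j)).eval (-x) ^ 2 := by
    obtain ⟨r, -, -, h⟩ := exists_laguerre_eq_nodal j α hα
    rw [h]
    exact eval_mul_eval_derivative_two_le_sq _ _ _ _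
  simp at hode
  set y := (laguerre α j).eval (-x)
  set T := (derivative (laguerre α j)).eval (-x)
  set U := (derivative (derivative (laguerre α j))).eval (-x)
  have h1 : (j : ℝ) * y ^ 2 = x * (y * U) + (α + 1 + x) * (-T) * y := by
    linear_combination y * hode
  have h2 : T ^ 2 ≤ (K * y) ^ 2 := sq_le_sq' (by linarith) (by linarith)
  have h3 : (α + 1 + x) * (-T) * y ≤ (α + 1 + x) * (K * y) * y := by
    have : 0 ≤ α + 1 + x := by linarith
    gcongr
  have h4 : x * (y * U) ≤ x * (K * y) ^ 2 := mul_le_mul_of_nonneg_left (hlag.trans h2) hx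
  have h5 : (x * K ^ 2 + (α + 1 + x) * K) * y ^ 2 < j * y ^ 2 :=
    mul_lt_mul_of_pos_right hj (by positivity)
  nlinarith

/-! ### The exceptional polynomials: degree and leading coefficient -/

theorem eval_excLaguerreI (α : ℝ) (m j : ℕ) (z : ℝ) :
    (excLaguerreI α m j).eval z =
      ((laguerre (α - 1) m).eval (-z) - (derivative (laguerre (α - 1) m)).eval (-z)) *
        (laguerre (α - 1) j).eval z
      - (laguerre (α - 1) m).eval (-z) * (derivative (laguerre (α - 1) j)).eval z := by
  have h := laguerre_add_one (α - 1) m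
  simp only [excLaguerreI, opAI, laguerreXi, h, eval_neg, eval_sub, eval_mul, eval_comp, eval_X]
  ring

theorem degree_laguerreXi (α : ℝ) (m : ℕ) : (laguerreXi α m).degree = m := by
  rw [laguerreXi, degree_comp_neg_X, degree_eq_natDegree (laguerre_ne_zero α m), natDegree_laguerre]

theorem leadingCoeff_laguerreXi (α : ℝ) (m : ℕ) :
    (laguerreXi α m).leadingCoeff = 1 / (m.factorial : ℝ) := by
  rw [laguerreXi, comp_neg_X_leadingCoeff_eq, natDegree_laguerre, leadingCoeff_laguerre,
    mul_div_assoc', ← mul_pow]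
  simp

theorem excLaguerreI_eq (α : ℝ) (m j : ℕ) :
    excLaguerreI α m j = laguerreXi α m * laguerre (α - 1) j
      - laguerreXi (α - 1) m * derivative (laguerre (α - 1) j) := by
  rw [excLaguerreI, opAI, sub_add_cancel, neg_sub]

theorem degree_laguerreXi_mul_derivative_lt (α : ℝ) (m j : ℕ) :
    (laguerreXi (α - 1) m * derivative (laguerre (α - 1) j)).degree
      < (laguerreXi α m * laguerre (α - 1) j).degree := by
  rw [degree_mul, degree_mul, degree_laguerreXi, degree_laguerreXi]
  exact WithBot.add_lt_add_left (WithBot.natCast_ne_bot m)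
    (degree_derivative_lt (laguerre_ne_zero _ _))

theorem leadingCoeff_excLaguerreI (α : ℝ) (m j : ℕ) :
    (excLaguerreI α m j).leadingCoeff
      = 1 / (m.factorial : ℝ) * ((-1) ^ j / (j.factorial : ℝ)) := by
  rw [excLaguerreI_eq, leadingCoeff_sub_of_degree_lt (degree_laguerreXi_mul_derivative_lt α m j),
    leadingCoeff_mul, leadingCoeff_laguerreXi, leadingCoeff_laguerre]

theorem natDegree_excLaguerreI (α : ℝ) (m j : ℕ) : (excLaguerreI α m j).natDegree = m + j := by
  apply natDegree_eq_of_degree_eq_some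
  rw [excLaguerreI_eq, degree_sub_eq_left_of_degree_lt (degree_laguerreXi_mul_derivative_lt α m j),
    degree_mul, degree_laguerreXi, degree_eq_natDegree (laguerre_ne_zero _ _), natDegree_laguerre]
  rfl

theorem excLaguerreI_ne_zero (α : ℝ) (m j : ℕ) : excLaguerreI α m j ≠ 0 := by
  rw [← leadingCoeff_ne_zero, leadingCoeff_excLaguerreI]
  simp [Nat.factorial_ne_zero]

/-! ### Zeros of the exceptional polynomials -/

/-- On the positive axis the exceptional polynomial changes sign between the zeros of
`L^{α-1}_j` and beyond the last one. -/
theorem exists_pos_zeros_excLaguerreI {α : ℝ} (hα : 0 < α) (m j : ℕ) :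
    ∃ v : Fin j → ℝ, StrictMono v ∧ (∀ i, 0 < v i) ∧
      ∀ i, (excLaguerreI α m j).eval (v i) = 0 := by
  obtain ⟨r, hr, hr0, h⟩ := exists_laguerre_eq_nodal j (α - 1) (by linarith)
  have hc0 : (-1) ^ j / (j.factorial : ℝ) ≠ 0 := by simp [Nat.factorial_ne_zero]
  obtain ⟨v, hv, hrv, -, hv0⟩ := exists_interlacing_roots hc0 hr (excLaguerreI α m j)
    (fun i => by
      have hne := eval_derivative_node_ne_zero hc0 hr i
      have hξ := eval_laguerre_neg_pos (show -1 < α - 1 by linarith) m (hr0 i).le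
      have hy : (laguerre (α - 1) j).eval (r i) = 0 := by
        rw [h, eval_C_mul, Lagrange.eval_nodal_at_node (Finset.mem_univ i), mul_zero]
      rw [eval_excLaguerreI, hy]
      rw [← h] at hne ⊢
      have := mul_pos hξ (pow_pos (abs_pos.2 hne) 2)
      rw [sq_abs] at this
      nlinarith)
    (by
      rw [leadingCoeff_excLaguerreI, mul_assoc, ← sq]
      positivity)
  exact ⟨v, hv, fun i => (hr0 i).trans (hrv i), hv0⟩

/-- In the variable `w = -z` the exceptional polynomial changes sign between the zeros of
`L^{α-1}_m` and beyond the last one. -/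
theorem exists_neg_zeros_excLaguerreI {α : ℝ} (hα : 0 < α) {m : ℕ} {w : Fin m → ℝ}
    (hw : StrictMono w) (hw0 : ∀ i, 0 < w i)
    (h : laguerre (α - 1) m = C ((-1) ^ m / (m.factorial : ℝ)) * Lagrange.nodal Finset.univ w)
    (j : ℕ) :
    ∃ u : Fin m → ℝ, StrictMono u ∧ (∀ i, w i < u i) ∧ (∀ i k, i < k → u i < w k) ∧
      ∀ i, (excLaguerreI α m j).eval (-u i) = 0 := by
  have hc0 : (-1) ^ m / (m.factorial : ℝ) ≠ 0 := by simp [Nat.factorial_ne_zero]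
  obtain ⟨u, hu, hwu, huw, hu0⟩ := exists_interlacing_roots hc0 hw
    ((excLaguerreI α m j).comp (-X))
    (fun i => by
      have hne := eval_derivative_node_ne_zero hc0 hw i
      have hy := eval_laguerre_neg_pos (show -1 < α - 1 by linarith) j (hw0 i).le
      have hM : (laguerre (α - 1) m).eval (w i) = 0 := by
        rw [h, eval_C_mul, Lagrange.eval_nodal_at_node (Finset.mem_univ i), mul_zero]
      rw [eval_comp, eval_neg, eval_X, eval_excLaguerreI, neg_neg, hM]
      rw [← h] at hne ⊢
      have := mul_pos hy (pow_pos (abs_pos.2 hne) 2)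
      rw [sq_abs] at this
      nlinarith)
    (by
      rw [comp_neg_X_leadingCoeff_eq, natDegree_excLaguerreI, leadingCoeff_excLaguerreI,
        show (-1 : ℝ) ^ (m + j) * (1 / (m.factorial : ℝ) * ((-1) ^ j / (j.factorial : ℝ))) *
          ((-1) ^ m / (m.factorial : ℝ))
          = ((-1) ^ m) ^ 2 * ((-1) ^ j) ^ 2 / ((m.factorial : ℝ) ^ 2 * j.factorial) by ring]
      positivity)
  exact ⟨u, hu, hwu, huw, fun i => by simpa [eval_comp] using hu0 i⟩

/-- The `m` negative and `j` positive zeros found by sign changes exhaust the degree `m + j`. -/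
theorem roots_excLaguerreI {α : ℝ} {m j : ℕ} {u : Fin m → ℝ} {v : Fin j → ℝ}
    (hu : StrictMono u) (hv : StrictMono v) (hu0 : ∀ i, 0 < u i) (hv0 : ∀ i, 0 < v i)
    (hPu : ∀ i, (excLaguerreI α m j).eval (-u i) = 0)
    (hPv : ∀ i, (excLaguerreI α m j).eval (v i) = 0) :
    (excLaguerreI α m j).roots
      = (Finset.univ.image (fun i => -u i) ∪ Finset.univ.image v).val := by
  refine roots_eq_of_natDegree_le_card_of_ne_zero (fun x hx => ?_) ?_ (excLaguerreI_ne_zero α m j)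
  · rcases Finset.mem_union.1 hx with hx | hx <;> obtain ⟨i, -, rfl⟩ := Finset.mem_image.1 hx
    exacts [hPu i, hPv i]
  · rw [Finset.card_union_of_disjoint, Finset.card_image_of_injective _
      (show Function.Injective fun i => -u i from neg_injective.comp hu.injective),
      Finset.card_image_of_injective _ hv.injective,
      natDegree_excLaguerreI]
    · simp
    · rw [Finset.disjoint_left]
      rintro x hx hx'
      obtain ⟨i, -, rfl⟩ := Finset.mem_image.1 hx
      obtain ⟨k, -, hk⟩ := Finset.mem_image.1 hx'
      linarith [hu0 i, hv0 k]

/-- The negative zeros of the exceptional polynomial, as `-u i`, with `u` interlacing the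
zeros `w` of `L^{α-1}_m`. -/
theorem neg_zeros_excLaguerreI {α : ℝ} (hα : 0 < α) {m : ℕ} {w : Fin m → ℝ}
    (hw : StrictMono w) (hw0 : ∀ i, 0 < w i)
    (h : laguerre (α - 1) m = C ((-1) ^ m / (m.factorial : ℝ)) * Lagrange.nodal Finset.univ w)
    (j : ℕ) :
    ∃ u : Fin m → ℝ, StrictMono u ∧ (∀ i, w i < u i) ∧ (∀ i k, i < k → u i < w k) ∧
      (∀ t, t < 0 ∧ (excLaguerreI α m j).eval t = 0 ↔ ∃ i, -u i = t) ∧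
      ∀ i, (excLaguerreI α m j).rootMultiplicity (-u i) = 1 := by
  obtain ⟨v, hv, hv0, hPv⟩ := exists_pos_zeros_excLaguerreI hα m j
  obtain ⟨u, hu, hwu, huw, hPu⟩ := exists_neg_zeros_excLaguerreI hα hw hw0 h j
  have hu0 : ∀ i, 0 < u i := fun i => (hw0 i).trans (hwu i)
  have hroots := roots_excLaguerreI hu hv hu0 hv0 hPu hPv
  refine ⟨u, hu, hwu, huw, fun t => ⟨fun ⟨ht, h0⟩ => ?_, ?_⟩, fun i => ?_⟩
  · have hmem := (mem_roots (excLaguerreI_ne_zero α m j)).2 h0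
    rw [hroots, Finset.mem_val, Finset.mem_union] at hmem
    rcases hmem with hmem | hmem <;> obtain ⟨i, -, rfl⟩ := Finset.mem_image.1 hmem
    · exact ⟨i, rfl⟩
    · linarith [hv0 i]
  · rintro ⟨i, rfl⟩
    exact ⟨neg_lt_zero.2 (hu0 i), hPu i⟩
  · rw [← count_roots, hroots]
    exact Multiset.count_eq_one_of_mem (Finset.nodup _) (by simp)

/-! ### Convergence of the negative zeros -/

/-- For large `j` the exceptional polynomial has the sign of `L^{α-1}_m` at `-x`, since there the
term with `(L^{α-1}_j)'` outweighs `(L^{α-1}_m)' L^{α-1}_j`. -/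
theorem eventually_eval_mul_eval_excLaguerreI_pos {α : ℝ} (hα : 0 < α) (m : ℕ) {x : ℝ}
    (hx : 0 ≤ x) (hM : (laguerre (α - 1) m).eval x ≠ 0) :
    ∀ᶠ j in atTop, 0 < (laguerre (α - 1) m).eval x * (excLaguerreI α m j).eval (-x) := by
  set M := (laguerre (α - 1) m).eval x with hMdef
  set M' := (derivative (laguerre (α - 1) m)).eval x with hM'def
  have hα' : -1 < α - 1 := by linarith
  filter_upwards [eventually_mul_eval_lt_neg_eval_derivative hα' hx |M' / M|] with j hj
  have hy := eval_laguerre_neg_pos hα' j hx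
  have hM2 : 0 < M ^ 2 := by positivity
  rw [eval_excLaguerreI, neg_neg, ← hMdef, ← hM'def]
  set y := (laguerre (α - 1) j).eval (-x)
  set T := (derivative (laguerre (α - 1) j)).eval (-x)
  have h1 : M * M' ≤ M ^ 2 * |M' / M| := by
    have : M * M' = M ^ 2 * (M' / M) := by field_simp
    rw [this]
    exact mul_le_mul_of_nonneg_left (le_abs_self _) hM2.le
  nlinarith [mul_lt_mul_of_pos_left hj hM2, mul_le_mul_of_nonneg_right h1 hy.le, mul_pos hM2 hy]

/-- The sign of the exceptional polynomial at `-w i`, and for large `j` at a point just beyond it,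
forces a zero between them. -/
theorem tendsto_neg_zeros_excLaguerreI {α : ℝ} (hα : 0 < α) {m : ℕ} {w : Fin m → ℝ}
    (hw : StrictMono w) (hw0 : ∀ i, 0 < w i)
    (h : laguerre (α - 1) m = C ((-1) ^ m / (m.factorial : ℝ)) * Lagrange.nodal Finset.univ w)
    {u : ℕ → Fin m → ℝ} (hwu : ∀ j i, w i < u j i)
    (huw : ∀ j i k, i < k → u j i < w k)
    (hz : ∀ j t, t < 0 ∧ (excLaguerreI α m j).eval t = 0 ↔ ∃ i, -u j i = t) (i : Fin m) :
    Tendsto (fun j => u j i) atTop (𝓝 (w i)) := by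
  have hc0 : (-1) ^ m / (m.factorial : ℝ) ≠ 0 := by simp [Nat.factorial_ne_zero]
  refine tendsto_order.2 ⟨fun b hb => Eventually.of_forall fun j => hb.trans (hwu j i),
    fun b hb => ?_⟩
  -- a point `x` between `w i` and both `b` and the next zero of `L^{α-1}_m`
  obtain ⟨x, hix, hxb, hxw⟩ : ∃ x, w i < x ∧ x < b ∧ ∀ k, i < k → x < w k := by
    have : ∀ᶠ x in 𝓝[>] (w i), x < b ∧ ∀ k, i < k → x < w k := by
      refine (eventually_nhdsWithin_of_eventually_nhds (eventually_lt_nhds hb)).and ?_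
      refine eventually_all.2 fun k => ?_
      by_cases hk : i < k
      · filter_upwards [eventually_nhdsWithin_of_eventually_nhds (eventually_lt_nhds (hw hk))]
          with x hx _ using hx
      · exact Eventually.of_forall fun x hk' => absurd hk' hk
    obtain ⟨x, hx, hix⟩ := (this.and self_mem_nhdsWithin).exists
    exact ⟨x, hix, hx.1, hx.2⟩
  have hpos := eval_derivative_mul_eval_pos_of_gt hc0 hw hix hxw
  rw [← h] at hpos
  have hMx : (laguerre (α - 1) m).eval x ≠ 0 := right_ne_zero_of_mul hpos.ne'
  filter_upwards [eventually_eval_mul_eval_excLaguerreI_pos hα m ((hw0 i).trans hix).le hMx]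
    with j hj
  have hy := eval_laguerre_neg_pos (show -1 < α - 1 by linarith) j (hw0 i).le
  have hM : (laguerre (α - 1) m).eval (w i) = 0 := by
    rw [h, eval_C_mul, Lagrange.eval_nodal_at_node (Finset.mem_univ i), mul_zero]
  have hsign : (excLaguerreI α m j).eval (-x) * (excLaguerreI α m j).eval (-w i) < 0 := by
    rw [eval_excLaguerreI α m j (-w i), neg_neg, hM]
    set D := (derivative (laguerre (α - 1) m)).eval (w i)
    set E := (laguerre (α - 1) m).eval x
    set G := (excLaguerreI α m j).eval (-x)
    have h1 : 0 < D * G := by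
      by_contra hcon
      push Not at hcon
      nlinarith [mul_pos hpos hj, mul_nonneg (sq_nonneg E) (neg_nonneg.2 hcon)]
    nlinarith [mul_pos h1 hy]
  obtain ⟨t, ht1, ht2, ht0⟩ := exists_eval_eq_zero_of_mul_neg _ (neg_lt_neg hix) hsign
  obtain ⟨k, hk⟩ := (hz j t).1 ⟨by linarith [hw0 i], ht0⟩
  -- the zero found in `(w i, x)` is `u j i`, the only one between `w i` and the next node
  rcases lt_trichotomy k i with hki | rfl | hki
  · linarith [huw j k i hki]
  · linarith
  · linarith [hwu j k, hxw k hki]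

/-- The enumerations `x j` and `ζ` are increasing, hence uniquely determined. -/
theorem mainTheorem4 (α : ℝ) (hα : 0 < α) (m : ℕ) :
    ∃ (x : ℕ → Fin m → ℝ) (ζ : Fin m → ℝ),
      -- the `m` zeros of `L^I_{α,m,m+j}` in `(-∞, 0)`, all simple, for every `j`
      (∀ j, StrictMono (x j) ∧
        Set.range (x j) = {t : ℝ | t < 0 ∧ (excLaguerreI α m j).eval t = 0} ∧
        ∀ i, (excLaguerreI α m j).rootMultiplicity (x j i) = 1) ∧
      -- the `m` zeros of `L^{α-1}_m(-z)` in the complex plane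
      StrictMono ζ ∧
      Set.range (fun i => (ζ i : ℂ)) =
        {z : ℂ | aeval (-z) (laguerre (α - 1) m) = 0} ∧
      -- they lie in `(-∞, 0)` and are simple
      (∀ i, ζ i < 0 ∧ (laguerreXi (α - 1) m).rootMultiplicity (ζ i) = 1) ∧
      ∀ i, Tendsto (fun j => x j i) atTop (𝓝 (ζ i)) := by
  obtain ⟨w, hw, hw0, h⟩ := exists_laguerre_eq_nodal m (α - 1) (by linarith)
  choose u hu hwu huw hz hmult using neg_zeros_excLaguerreI hα hw hw0 h
  have hrev : ∀ {f : Fin m → ℝ}, StrictMono f → StrictMono fun i : Fin m => -f i.rev :=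
    fun hf i k hik => neg_lt_neg (hf (Fin.rev_lt_rev.2 hik))
  refine ⟨fun j i => -u j i.rev, fun i => -w i.rev, fun j => ⟨hrev (hu j), ?_, fun i => hmult j _⟩,
    hrev hw, ?_, fun i => ⟨neg_lt_zero.2 (hw0 _), ?_⟩,
    fun i => (tendsto_neg_zeros_excLaguerreI hα hw hw0 h hwu huw hz i.rev).neg⟩
  · ext t
    rw [Set.mem_ofPred_eq, hz, Set.mem_range]
    exact (Fin.rev_surjective.exists (p := fun i => -u j i = t)).symm
  · ext z
    rw [Set.mem_ofPred_eq, Set.mem_range, h, Lagrange.nodal_eq]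
    simp only [map_mul, map_prod, map_sub, aeval_X, aeval_C, mul_eq_zero, Finset.prod_eq_zero_iff,
      Finset.mem_univ, true_and]
    rw [or_iff_right (by simp [Nat.factorial_ne_zero])]
    constructor
    · rintro ⟨i, rfl⟩
      exact ⟨i.rev, by simp⟩
    · rintro ⟨i, hi⟩
      refine ⟨i.rev, ?_⟩
      rw [Fin.rev_rev]
      push_cast
      rw [← neg_neg z, sub_eq_zero.1 hi]
      rfl
  · have hroots : (laguerre (α - 1) m).roots = (Finset.univ.image w).val :=
      roots_eq_of_natDegree_le_card_of_ne_zero (fun x hx => by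
        obtain ⟨i, -, rfl⟩ := Finset.mem_image.1 hx
        rw [h, eval_C_mul, Lagrange.eval_nodal_at_node (Finset.mem_univ i), mul_zero])
        (by rw [Finset.card_image_of_injective _ hw.injective, natDegree_laguerre]; simp)
        (laguerre_ne_zero _ _)
    rw [← count_roots, laguerreXi, roots_comp_neg_X,
      Multiset.count_map_eq_count' (fun x : ℝ => -x) _ neg_injective, hroots]
    exact Multiset.count_eq_one_of_mem (Finset.nodup _) (by simp)
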